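/- Let $G$ be a finite digraph (loops and multiple arcs allowed) with nonempty vertex set $\{v_1,\dots,v_n\}$ and adjacency matrix $A=A(G)$, whose $(i,j)$ entry is the number of arcs from $v_i$ to $v_j$. Let $\rho(G)$ be the maximum modulus of the eigenvalues of $A$, and let $d_i^{k+}=\sum_j (A^k)_{ij}$ be the number of directed walks of length $k$ starting at $v_i$ (so $d_i^{0+}=1$). Suppose that $G$ has no sinks, i.e. $d_i^{1+}\neq 0$ for all $i$. Then, for all integers $L>0$ and $k\ge 0$, $$\min_{1\le i\le n}\left(\frac{d_i^{(k+L)+}}{d_i^{k+}}\right)^{1/L}\le\rho(G)\le\max_{1\le i\le n}\left(\frac{d_i^{(k+L)+}}{d_i^{k+}}\right)^{1/L}.$$ Moreover, suppose that $G$ is strongly connected, let $h(G)$ be its index of imprimitivity, i.e. the number of eigenvalues of $A$ of modulus $\rho(G)$, and let $r=\gcd(L,h(G))$. Then equality holds in the left inequality if and only if $G$ is average $(k+1)$-outdegree regular or average $(k+1)$-outdegree $r$-quasiregular (or both), and the same condition is necessary and sufficient for equality in the right inequality. Here, for $\kappa\ge1$, $G$ is called average $\kappa$-outdegree regular if $d_i^{\kappa+}/d_i^{(\kappa-1)+}$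 is the same for all $i$; and $G$ is called average $\kappa$-outdegree $r$-quasiregular if $r>1$, $r$ divides $h(G)$, and the vertex set has a partition into nonempty parts $V_1,\dots,V_r$ such that every arc starting in $V_j$ ends in $V_{(j \bmod r)+1}$ and $d_i^{\kappa+}/d_i^{(\kappa-1)+}$ is constant over the vertices $v_i$ of each part $V_j$. -/

import Mathlib

/-! A finite digraph (loops and parallel arcs allowed) is a quiver on a finite vertex type `V`
whose types of arrows `i ⟶ j` are finite. -/

namespace FinDigraph

/-- The adjacency matrix: the `(i, j)` entry is the number of arcs from `i` to `j`. -/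
def adjMatrix (V : Type*) [Quiver V] [∀ i j : V, Fintype (i ⟶ j)] : Matrix V V ℕ :=
  Matrix.of fun i j => Fintype.card (i ⟶ j)

/-- The `k`-outdegree of the vertex `i`: the `i`-th row sum of the `k`-th power of the adjacency
matrix, that is, the number of directed walks of length `k` starting at `i`. -/
def kOutdegree {V : Type*} [Quiver V] [∀ i j : V, Fintype (i ⟶ j)] [Fintype V] [DecidableEq V]
    (k : ℕ) (i : V) : ℕ :=
  ∑ j, (adjMatrix V ^ k) i j

/-- The outdegree of a vertex: the number of arcs with initial vertex `i`. -/
def outdegree {V : Type*} [Quiver V] [∀ i j : V, Fintype (i ⟶ j)] [Fintype V] (i : V) : ℕ :=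
  ∑ j, adjMatrix V i j

/-- A sink is a vertex with no outgoing arcs. -/
def IsSink {V : Type*} [Quiver V] [∀ i j : V, Fintype (i ⟶ j)] [Fintype V] (i : V) : Prop :=
  outdegree i = 0

/-- The adjacency matrix with complex entries. -/
noncomputable def adjMatrixC (V : Type*) [Quiver V] [∀ i j : V, Fintype (i ⟶ j)] :
    Matrix V V ℂ :=
  (adjMatrix V).map (Nat.cast : ℕ → ℂ)

/-- The spectral radius of the digraph: the maximum modulus of the (complex) eigenvalues of its
adjacency matrix. -/
noncomputable def rho (V : Type*) [Quiver V] [∀ i j : V, Fintype (i ⟶ j)] [Fintype V]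
    [DecidableEq V] : ℝ :=
  (spectralRadius ℂ (adjMatrixC V)).toReal

/-- The index of imprimitivity: the number of eigenvalues of the adjacency matrix whose modulus is
the spectral radius. It is used for strongly connected digraphs only. -/
noncomputable def imprimitivityIndex (V : Type*) [Quiver V] [∀ i j : V, Fintype (i ⟶ j)]
    [Fintype V] [DecidableEq V] : ℕ :=
  {μ : ℂ | μ ∈ spectrum ℂ (adjMatrixC V) ∧ ‖μ‖ = rho V}.ncard

/-- Average `κ`-outdegree regular, for `κ ≥ 1`: the ratio of the `κ`-outdegree to the
`(κ - 1)`-outdegree is the same at all vertices. -/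
def IsAverageOutdegreeRegular (V : Type*) [Quiver V] [∀ i j : V, Fintype (i ⟶ j)] [Fintype V]
    [DecidableEq V] (κ : ℕ) : Prop :=
  1 ≤ κ ∧ ∃ c : ℝ, ∀ i : V, (kOutdegree κ i : ℝ) / (kOutdegree (κ - 1) i : ℝ) = c

/-- Cyclically `r`-partite: `r > 1` and `r` divides the index of imprimitivity. -/
def IsCyclicallyPartite (V : Type*) [Quiver V] [∀ i j : V, Fintype (i ⟶ j)] [Fintype V]
    [DecidableEq V] (r : ℕ) : Prop :=
  1 < r ∧ r ∣ imprimitivityIndex V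

/-- `m` is the block map of a partition of the vertices into `r` nonempty parts, indexed cyclically,
such that every arc leads from a part to the next one. -/
def IsCyclicPartition {V : Type*} [Quiver V] {r : ℕ} (m : V → ZMod r) : Prop :=
  Function.Surjective m ∧ ∀ i j : V, Nonempty (i ⟶ j) → m j = m i + 1

/-- Average `κ`-outdegree `r`-quasiregular, for `κ ≥ 1`: cyclically `r`-partite, and the ratio of
the `κ`-outdegree to the `(κ - 1)`-outdegree is constant on each of the `r` cyclic parts. For a
strongly connected digraph the cyclic partition is unique up to rotation of the index. -/
def IsAverageOutdegreeQuasiregular (V : Type*) [Quiver V] [∀ i j : V, Fintype (i ⟶ j)] [Fintype V]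
    [DecidableEq V] (κ r : ℕ) : Prop :=
  1 ≤ κ ∧ IsCyclicallyPartite V r ∧
    ∃ m : V → ZMod r, IsCyclicPartition m ∧
      ∃ c : ZMod r → ℝ, ∀ i : V, (kOutdegree κ i : ℝ) / (kOutdegree (κ - 1) i : ℝ) = c (m i)

/-- The quantity `(d_i^{(k+L)+} / d_i^{k+})^{1/L}`. -/
noncomputable def meanGrowth {V : Type*} [Quiver V] [∀ i j : V, Fintype (i ⟶ j)] [Fintype V]
    [DecidableEq V] (k L : ℕ) (i : V) : ℝ :=
  ((kOutdegree (k + L) i : ℝ) / (kOutdegree k i : ℝ)) ^ ((1 : ℝ) / (L : ℝ))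

end FinDigraph

/-!
Write `A` for the adjacency matrix, `ρ` for its spectral radius and `d` for the vector of
`k`-outdegrees, which is positive because there are no sinks. The numbers `meanGrowth k L i` are the
`L`-th roots of the ratios `(A ^ L d) i / d i`.

**Bounds.** If `γ ^ L d ≤ A ^ L d`, then `x = ∑_{s < L} γ ^ (L - 1 - s) A ^ s d` is positive and
`A x - γ x = A ^ L d - γ ^ L d ≥ 0` (`Matrix.mulVec_geom_sum`), so the Collatz–Wielandt bound
`Matrix.le_complexSpectralRadius_of_le_mulVec`, a consequence of Gelfand's formula, gives `γ ≤ ρ`.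
The upper bound is the same, with a direct estimate of eigenvectors in place of Gelfand's formula.

**Equality forces an eigenvector.** Let the digraph be strongly connected. If either bound is
attained, then `A x - ρ x` has constant sign for `x` as above with `γ = ρ`. If it were not zero, a
sum of powers of `A` would turn `x` into a vector with strict inequality at every vertex,
contradicting the bounds for a number slightly different from `ρ`. So `A x = ρ x` and
`A ^ L d = ρ ^ L d` (`FinDigraph.pow_mulVec_kOutdegree_eq`).

**From the eigenvector to the blocks.** An eigenvector of `A` for `ρ ζ` with `‖ζ‖ = 1`, divided by
`x`, is multiplied by `ζ` along every arc (`Matrix.div_eq_mul_div_of_peripheral`, a maximum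
principle). So the peripheral eigenvalues divided by `ρ` form a finite group of complex units, which
is cyclic, of order the index of imprimitivity `h`. A generator yields the cyclic partition into `r`
parts for every `r ∣ h` (`FinDigraph.exists_isCyclicPartition`). A Fourier transform over the `L`-th
roots of unity writes `d` as a sum of eigenvectors of `A` for `ρ ζ` with `ζ ^ L = 1`; those that do
not vanish also have `ζ ^ h = 1`, so they are, relative to `x`, constant on the blocks modulo
`gcd L h`. The same follows for `d` and `A d`, hence for the ratio `(A d) i / d i`
(`FinDigraph.exists_isCyclicPartition_div_eq`).

**Converse.** If the ratio depends only on the block and the number `r` of blocks divides `L`, then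
`(A ^ L d) i / d i` is a product over `L / r` full turns around the blocks, the same for all `i`.
All the `meanGrowth k L i` are then equal, and the bounds make them equal to `ρ`
(`FinDigraph.meanGrowth_eq_rho`).
-/

/-! ### Eigenvectors and Collatz–Wielandt bounds for nonnegative matrices -/

namespace Matrix

open scoped Matrix

variable {V : Type*} [Fintype V]

lemma mem_spectrum_iff_exists_mulVec_eq_smul {K : Type*} [Field K] [DecidableEq V]
    {A : Matrix V V K} {μ : K} :
    μ ∈ spectrum K A ↔ ∃ v : V → K, v ≠ 0 ∧ A *ᵥ v = μ • v := by
  rw [← Matrix.spectrum_toLin', ← Module.End.hasEigenvalue_iff_mem_spectrum]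
  constructor
  · intro h
    obtain ⟨v, hv⟩ := h.exists_hasEigenvector
    exact ⟨v, hv.2, by simpa using hv.apply_eq_smul⟩
  · rintro ⟨v, hv, h⟩
    exact Module.End.hasEigenvalue_of_hasEigenvector
      (Module.End.hasEigenvector_iff.2 ⟨Module.End.mem_eigenspace_iff.2 (by simpa using h), hv⟩)

lemma mulVec_mono {B : Matrix V V ℝ} (hB : ∀ i j, 0 ≤ B i j) {z w : V → ℝ} (h : z ≤ w) :
    B *ᵥ z ≤ B *ᵥ w :=
  fun i => Finset.sum_le_sum fun j _ => mul_le_mul_of_nonneg_left (h j) (hB i j)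

variable [DecidableEq V]

/-- The spectral radius of a real matrix, over the complex numbers, as a real number. -/
noncomputable def complexSpectralRadius (B : Matrix V V ℝ) : ℝ :=
  (spectralRadius ℂ (B.map ((↑) : ℝ → ℂ))).toReal

lemma spectralRadius_ne_top (A : Matrix V V ℂ) [Nonempty V] : spectralRadius ℂ A ≠ ⊤ := by
  let _ := Matrix.linftyOpNormedRing (n := V) (α := ℂ)
  let _ := Matrix.linftyOpNormedAlgebra (n := V) (R := ℂ) (α := ℂ)
  exact ((spectrum.spectralRadius_le_nnnorm A).trans_lt ENNReal.coe_lt_top).ne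

/-- Upper Collatz–Wielandt bound for a single eigenvalue: compare the eigenvector with `z` at an
index where `‖v i‖ / z i` is largest. -/
lemma norm_le_of_mulVec_le [Nonempty V] {B : Matrix V V ℝ} (hB : ∀ i j, 0 ≤ B i j) {z : V → ℝ}
    (hz : ∀ i, 0 < z i) {c : ℝ} (h : ∀ i, (B *ᵥ z) i ≤ c * z i) {μ : ℂ}
    (hμ : μ ∈ spectrum ℂ (B.map ((↑) : ℝ → ℂ))) : ‖μ‖ ≤ c := by
  obtain ⟨v, hv0, hv⟩ := mem_spectrum_iff_exists_mulVec_eq_smul.1 hμ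
  obtain ⟨i, hi⟩ := Finite.exists_max fun i => ‖v i‖ / z i
  have hvle : ∀ j, ‖v j‖ ≤ ‖v i‖ / z i * z j := fun j => (div_le_iff₀ (hz j)).1 (hi j)
  have hvi : 0 < ‖v i‖ := by
    obtain ⟨j, hj⟩ := Function.ne_iff.1 hv0
    have h1 : 0 < ‖v i‖ / z i := (div_pos (norm_pos_iff.2 hj) (hz j)).trans_le (hi j)
    have h2 := mul_pos h1 (hz i)
    rwa [div_mul_cancel₀ _ (hz i).ne'] at h2
  have hvi' := congrFun hv i
  have key : ‖μ‖ * ‖v i‖ ≤ c * ‖v i‖ := by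
    calc ‖μ‖ * ‖v i‖ = ‖(B.map ((↑) : ℝ → ℂ) *ᵥ v) i‖ := by rw [hvi']; simp
      _ ≤ ∑ j, ‖(B i j : ℂ) * v j‖ := by
        simp only [mulVec, dotProduct, map_apply]
        exact norm_sum_le _ _
      _ ≤ ∑ j, B i j * (‖v i‖ / z i * z j) := by
        refine Finset.sum_le_sum fun j _ => ?_
        rw [norm_mul, Complex.norm_real, Real.norm_of_nonneg (hB i j)]
        exact mul_le_mul_of_nonneg_left (hvle j) (hB i j)
      _ = ‖v i‖ / z i * (B *ᵥ z) i := by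
        simp only [mulVec, dotProduct, Finset.mul_sum]
        exact Finset.sum_congr rfl fun j _ => by ring
      _ ≤ ‖v i‖ / z i * (c * z i) :=
        mul_le_mul_of_nonneg_left (h i) (div_nonneg (norm_nonneg _) (hz i).le)
      _ = c * ‖v i‖ := by
        field_simp [(hz i).ne']
  exact le_of_mul_le_mul_right key hvi

lemma complexSpectralRadius_le_of_mulVec_le [Nonempty V] {B : Matrix V V ℝ}
    (hB : ∀ i j, 0 ≤ B i j) {z : V → ℝ} (hz : ∀ i, 0 < z i) {c : ℝ}
    (h : ∀ i, (B *ᵥ z) i ≤ c * z i) : complexSpectralRadius B ≤ c := by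
  have hc : 0 ≤ c := by
    obtain ⟨i⟩ := ‹Nonempty V›
    have h0 : 0 ≤ (B *ᵥ z) i := Finset.sum_nonneg fun j _ => mul_nonneg (hB i j) (hz j).le
    exact nonneg_of_mul_nonneg_left (h0.trans (h i)) (hz i)
  refine ENNReal.toReal_le_of_le_ofReal hc (iSup₂_le fun μ hμ => ?_)
  rw [← ENNReal.ofReal_coe_nnreal]
  exact ENNReal.ofReal_le_ofReal (norm_le_of_mulVec_le hB hz h hμ)

/-- Lower Collatz–Wielandt bound. Iterating `c z ≤ B z` gives `c ^ m ≤ ‖B ^ m‖`, and Gelfand's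
formula turns this into a bound for the spectral radius. -/
lemma le_complexSpectralRadius_of_le_mulVec [Nonempty V] {B : Matrix V V ℝ}
    (hB : ∀ i j, 0 ≤ B i j) {z : V → ℝ} (hz : ∀ i, 0 < z i) {c : ℝ} (hc : 0 ≤ c)
    (h : ∀ i, c * z i ≤ (B *ᵥ z) i) : c ≤ complexSpectralRadius B := by
  have hpow : ∀ m : ℕ, ∀ i, c ^ m * z i ≤ ((B ^ m) *ᵥ z) i := by
    intro m
    induction m with
    | zero => simp
    | succ m ih =>
      intro i
      rw [pow_succ', pow_succ', ← mulVec_mulVec]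
      have h1 : (B *ᵥ (c ^ m • z)) i ≤ (B *ᵥ ((B ^ m) *ᵥ z)) i :=
        mulVec_mono hB (fun j => by simpa using ih j) i
      rw [mulVec_smul, Pi.smul_apply, smul_eq_mul] at h1
      have h2 := mul_le_mul_of_nonneg_left (h i) (pow_nonneg hc m)
      linarith
  let _ := Matrix.linftyOpNormedRing (n := V) (α := ℂ)
  let _ := Matrix.linftyOpNormedAlgebra (n := V) (R := ℂ) (α := ℂ)
  set A : Matrix V V ℂ := B.map ((↑) : ℝ → ℂ) with hA
  have hApow : ∀ m : ℕ, A ^ m = (B ^ m).map ((↑) : ℝ → ℂ) := fun m =>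
    (Matrix.map_pow B Complex.ofRealHom m).symm
  have hnorm : ∀ m : ℕ, c ^ m ≤ ‖A ^ m‖ := by
    intro m
    obtain ⟨i, hi⟩ := Finite.exists_max z
    set w : V → ℂ := fun j => (z j : ℂ) with hw
    have h1 : ((A ^ m) *ᵥ w) i = (((B ^ m) *ᵥ z) i : ℝ) := by
      rw [hApow]
      simp [mulVec, dotProduct, hw]
    have h2 : ‖w‖ ≤ z i := (pi_norm_le_iff_of_nonneg (hz i).le).2 fun j => by
      simpa [hw, abs_of_pos (hz j)] using hi j
    have h3 : c ^ m * z i ≤ ‖A ^ m‖ * z i := by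
      calc c ^ m * z i ≤ ((B ^ m) *ᵥ z) i := hpow m i
        _ ≤ ‖((A ^ m) *ᵥ w) i‖ := by
          rw [h1, Complex.norm_real]; exact le_abs_self _
        _ ≤ ‖(A ^ m) *ᵥ w‖ := norm_le_pi_norm _ i
        _ ≤ ‖A ^ m‖ * ‖w‖ := Matrix.linfty_opNorm_mulVec _ _
        _ ≤ ‖A ^ m‖ * z i := mul_le_mul_of_nonneg_left h2 (norm_nonneg _)
    exact le_of_mul_le_mul_right h3 (hz i)
  have hlim := spectrum.pow_norm_pow_one_div_tendsto_nhds_spectralRadius A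
  have hle : ENNReal.ofReal c ≤ spectralRadius ℂ A := by
    refine ge_of_tendsto hlim ?_
    filter_upwards [Filter.eventually_gt_atTop 0] with m hm
    refine ENNReal.ofReal_le_ofReal ?_
    calc c = (c ^ m) ^ (1 / m : ℝ) := by
          rw [one_div, Real.pow_rpow_inv_natCast hc hm.ne']
      _ ≤ ‖A ^ m‖ ^ (1 / m : ℝ) :=
        Real.rpow_le_rpow (pow_nonneg hc m) (hnorm m) (by positivity)
  have := ENNReal.toReal_mono (spectralRadius_ne_top A) hle
  rwa [ENNReal.toReal_ofReal hc] at this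

/-! ### Powers of a nonnegative matrix -/

/-- The truncated sum `∑ γ ^ (L - 1 - s) B ^ s d` for `s < L`, on which `B - γ` acts as
`B ^ L - γ ^ L` does on `d`. -/
lemma mulVec_geom_sum {R : Type*} [CommRing R] (B : Matrix V V R) (γ : R) (d : V → R) (L : ℕ) :
    B *ᵥ (∑ s ∈ Finset.range L, γ ^ (L - 1 - s) • ((B ^ s) *ᵥ d))
      - γ • (∑ s ∈ Finset.range L, γ ^ (L - 1 - s) • ((B ^ s) *ᵥ d))
      = (B ^ L) *ᵥ d - γ ^ L • d := by
  have hcomm : Commute B (γ • (1 : Matrix V V R)) := (Commute.one_right B).smul_right γ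
  have h := hcomm.mul_geom_sum₂ L
  have h' := congrArg (fun M => M *ᵥ d) h
  simp only [sub_mulVec, ← mulVec_mulVec, smul_pow, one_pow, smul_mulVec, one_mulVec,
    sum_mulVec, mul_smul_comm, mul_one] at h'
  exact h'

lemma pow_nonneg_entry {B : Matrix V V ℝ} (hB : ∀ i j, 0 ≤ B i j) (s : ℕ) (i j : V) :
    0 ≤ (B ^ s) i j := by
  induction s generalizing i j with
  | zero => rw [pow_zero, one_apply]; split_ifs <;> norm_num
  | succ s ih =>
    rw [pow_succ, mul_apply]
    exact Finset.sum_nonneg fun k _ => mul_nonneg (ih i k) (hB k j)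

end Matrix

namespace Matrix

open scoped Matrix

variable {V : Type*} [Fintype V]

lemma mulVec_pos_of_row_pos {B : Matrix V V ℝ} (hB : ∀ i j, 0 ≤ B i j)
    (hrow : ∀ i, ∃ j, 0 < B i j) {z : V → ℝ} (hz : ∀ i, 0 < z i) (i : V) : 0 < (B *ᵥ z) i := by
  obtain ⟨j, hj⟩ := hrow i
  exact Finset.sum_pos' (fun k _ => mul_nonneg (hB i k) (hz k).le)
    ⟨j, Finset.mem_univ j, mul_pos hj (hz j)⟩

section Irreducible

variable [DecidableEq V]

lemma pow_mulVec_pos_of_row_pos {B : Matrix V V ℝ} (hB : ∀ i j, 0 ≤ B i j)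
    (hrow : ∀ i, ∃ j, 0 < B i j) {z : V → ℝ} (hz : ∀ i, 0 < z i) (s : ℕ) (i : V) :
    0 < ((B ^ s) *ᵥ z) i := by
  induction s generalizing i with
  | zero => simpa using hz i
  | succ s ih =>
    rw [pow_succ', ← mulVec_mulVec]
    exact mulVec_pos_of_row_pos hB hrow ih i

lemma geom_sum_mulVec_pos {B : Matrix V V ℝ} (hB : ∀ i j, 0 ≤ B i j)
    (hrow : ∀ i, ∃ j, 0 < B i j) {d : V → ℝ} (hd : ∀ i, 0 < d i) {γ : ℝ} (hγ : 0 ≤ γ) {L : ℕ}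
    (hL : 0 < L) (i : V) :
    0 < (∑ s ∈ Finset.range L, γ ^ (L - 1 - s) • ((B ^ s) *ᵥ d)) i := by
  rw [Finset.sum_apply]
  refine Finset.sum_pos' (fun s _ => mul_nonneg (pow_nonneg hγ _)
    (pow_mulVec_pos_of_row_pos hB hrow hd s i).le) ⟨L - 1, Finset.mem_range.2 (by omega), ?_⟩
  simpa using pow_mulVec_pos_of_row_pos hB hrow hd (L - 1) i

lemma le_complexSpectralRadius_of_le_pow_mulVec [Nonempty V] {B : Matrix V V ℝ}
    (hB : ∀ i j, 0 ≤ B i j) (hrow : ∀ i, ∃ j, 0 < B i j) {d : V → ℝ} (hd : ∀ i, 0 < d i) {γ : ℝ}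
    (hγ : 0 ≤ γ) {L : ℕ} (hL : 0 < L) (h : ∀ i, γ ^ L * d i ≤ ((B ^ L) *ᵥ d) i) :
    γ ≤ complexSpectralRadius B := by
  refine le_complexSpectralRadius_of_le_mulVec hB (geom_sum_mulVec_pos hB hrow hd hγ hL) hγ
    fun i => ?_
  have h1 := congrFun (mulVec_geom_sum B γ d L) i
  rw [Pi.sub_apply, Pi.sub_apply, Pi.smul_apply, Pi.smul_apply, smul_eq_mul, smul_eq_mul] at h1
  linarith [h i]

lemma complexSpectralRadius_le_of_pow_mulVec_le [Nonempty V] {B : Matrix V V ℝ}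
    (hB : ∀ i j, 0 ≤ B i j) (hrow : ∀ i, ∃ j, 0 < B i j) {d : V → ℝ} (hd : ∀ i, 0 < d i) {γ : ℝ}
    (hγ : 0 ≤ γ) {L : ℕ} (hL : 0 < L) (h : ∀ i, ((B ^ L) *ᵥ d) i ≤ γ ^ L * d i) :
    complexSpectralRadius B ≤ γ := by
  refine complexSpectralRadius_le_of_mulVec_le hB (geom_sum_mulVec_pos hB hrow hd hγ hL)
    fun i => ?_
  have h1 := congrFun (mulVec_geom_sum B γ d L) i
  rw [Pi.sub_apply, Pi.sub_apply, Pi.smul_apply, Pi.smul_apply, smul_eq_mul, smul_eq_mul] at h1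
  linarith [h i]

/-! ### Equality in the Collatz–Wielandt bounds for irreducible matrices -/

/-- For an irreducible matrix, a sum of powers of `B` spreads a nonzero nonnegative vector over all
indices; as it contains `B ^ 0`, it keeps positive vectors positive. -/
lemma exists_commute_mulVec_pos {B : Matrix V V ℝ} (hB : ∀ i j, 0 ≤ B i j)
    (hirr : ∀ i j, Relation.ReflTransGen (fun a b => 0 < B a b) i j) {y : V → ℝ}
    (hy : ∀ i, 0 ≤ y i) (hy0 : ∃ i, 0 < y i) :
    ∃ P : Matrix V V ℝ, Commute P B ∧ (∀ i, 0 < (P *ᵥ y) i) ∧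
      ∀ x : V → ℝ, (∀ i, 0 < x i) → ∀ i, 0 < (P *ᵥ x) i := by
  obtain ⟨j, hj⟩ := hy0
  have hnn : ∀ z : V → ℝ, (∀ i, 0 ≤ z i) → ∀ s i, 0 ≤ ((B ^ s) *ᵥ z) i := fun z hz s i =>
    Finset.sum_nonneg fun k _ => mul_nonneg (pow_nonneg_entry hB s i k) (hz k)
  have hex : ∀ i, ∃ s, 0 < ((B ^ s) *ᵥ y) i := by
    intro i
    induction hirr i j using Relation.ReflTransGen.head_induction_on with
    | refl => exact ⟨0, by simpa using hj⟩
    | @head a b hab _ ih =>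
      obtain ⟨s, hs⟩ := ih
      refine ⟨s + 1, ?_⟩
      rw [pow_succ', ← mulVec_mulVec]
      exact Finset.sum_pos' (fun k _ => mul_nonneg (hB a k) (hnn y hy s k))
        ⟨b, Finset.mem_univ b, mul_pos hab hs⟩
  choose s hs using hex
  refine ⟨∑ t ∈ Finset.range (Finset.univ.sup s + 1), B ^ t,
    Commute.sum_left _ _ _ fun t _ => Commute.pow_left (Commute.refl B) t,
    fun i => ?_, fun x hx i => ?_⟩
  · rw [sum_mulVec, Finset.sum_apply]
    exact Finset.sum_pos' (fun t _ => hnn y hy t i)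
      ⟨s i, Finset.mem_range.2 (Nat.lt_succ_of_le (Finset.le_sup (Finset.mem_univ i))), hs i⟩
  · rw [sum_mulVec, Finset.sum_apply]
    exact Finset.sum_pos' (fun t _ => hnn x (fun k => (hx k).le) t i)
      ⟨0, Finset.mem_range.2 (Nat.succ_pos _), by simpa using hx i⟩

/-- If `ρ x ≤ B x` with `x > 0` and `ρ` the spectral radius of the irreducible matrix `B`, then
`B x = ρ x`: otherwise the difference, spread over all indices, gives `c z ≤ B z` with `ρ < c`. -/
lemma mulVec_eq_of_complexSpectralRadius_le [Nonempty V] {B : Matrix V V ℝ}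
    (hB : ∀ i j, 0 ≤ B i j)
    (hirr : ∀ i j, Relation.ReflTransGen (fun a b => 0 < B a b) i j) {x : V → ℝ}
    (hx : ∀ i, 0 < x i) (h : ∀ i, complexSpectralRadius B * x i ≤ (B *ᵥ x) i) :
    B *ᵥ x = complexSpectralRadius B • x := by
  set ρ := complexSpectralRadius B with hρ
  have hρ0 : 0 ≤ ρ := ENNReal.toReal_nonneg
  by_contra hne
  have hy : ∀ i, 0 ≤ (B *ᵥ x - ρ • x) i := fun i => by simpa using h i
  have hy0 : ∃ i, 0 < (B *ᵥ x - ρ • x) i := by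
    by_contra! hcon
    exact hne (sub_eq_zero.1 (funext fun i => le_antisymm (hcon i) (hy i)))
  obtain ⟨P, hPB, hPy, hPpos⟩ := exists_commute_mulVec_pos hB hirr hy hy0
  have hz := hPpos x hx
  have hstrict : ∀ i, ρ * (P *ᵥ x) i < (B *ᵥ (P *ᵥ x)) i := by
    intro i
    have h1 := hPy i
    rw [mulVec_sub, mulVec_mulVec, hPB.eq, ← mulVec_mulVec, mulVec_smul] at h1
    simpa using h1
  obtain ⟨i, hi⟩ := Finite.exists_min fun i => (B *ᵥ (P *ᵥ x)) i / (P *ᵥ x) i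
  have hlt : ρ < (B *ᵥ (P *ᵥ x)) i / (P *ᵥ x) i := (lt_div_iff₀ (hz i)).2 (hstrict i)
  exact absurd (le_complexSpectralRadius_of_le_mulVec hB hz (hρ0.trans hlt.le)
    fun j => (le_div_iff₀ (hz j)).1 (hi j)) hlt.not_ge

/-- The companion of `mulVec_eq_of_complexSpectralRadius_le` for the opposite inequality. -/
lemma mulVec_eq_of_le_complexSpectralRadius [Nonempty V] {B : Matrix V V ℝ}
    (hB : ∀ i j, 0 ≤ B i j)
    (hirr : ∀ i j, Relation.ReflTransGen (fun a b => 0 < B a b) i j) {x : V → ℝ}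
    (hx : ∀ i, 0 < x i) (h : ∀ i, (B *ᵥ x) i ≤ complexSpectralRadius B * x i) :
    B *ᵥ x = complexSpectralRadius B • x := by
  set ρ := complexSpectralRadius B with hρ
  by_contra hne
  have hy : ∀ i, 0 ≤ (ρ • x - B *ᵥ x) i := fun i => by simpa using h i
  have hy0 : ∃ i, 0 < (ρ • x - B *ᵥ x) i := by
    by_contra! hcon
    exact hne (sub_eq_zero.1 (funext fun i => le_antisymm (hcon i) (hy i))).symm
  obtain ⟨P, hPB, hPy, hPpos⟩ := exists_commute_mulVec_pos hB hirr hy hy0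
  have hz := hPpos x hx
  have hstrict : ∀ i, (B *ᵥ (P *ᵥ x)) i < ρ * (P *ᵥ x) i := by
    intro i
    have h1 := hPy i
    rw [mulVec_sub, mulVec_mulVec, hPB.eq, ← mulVec_mulVec, mulVec_smul] at h1
    simpa using h1
  obtain ⟨i, hi⟩ := Finite.exists_max fun i => (B *ᵥ (P *ᵥ x)) i / (P *ᵥ x) i
  have hlt : (B *ᵥ (P *ᵥ x)) i / (P *ᵥ x) i < ρ := (div_lt_iff₀ (hz i)).2 (hstrict i)
  exact absurd (complexSpectralRadius_le_of_mulVec_le hB hz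
    fun j => (div_le_iff₀ (hz j)).1 (hi j)) hlt.not_ge

end Irreducible

/-! ### Peripheral eigenvectors of an irreducible matrix -/

/-- Let `x > 0` be an eigenvector for `ρ`, and `v` an eigenvector for `ρ ζ` with `‖ζ‖ = 1`. Where
`‖v i‖ / x i` is maximal, `ζ v i / x i` is a weighted average of the `v j / x j`, all of which lie
in the disc of radius `‖v i‖ / x i`; so they are all equal to it. Irreducibility carries this
to every `i`. -/
lemma div_eq_mul_div_of_peripheral {B : Matrix V V ℝ} (hB : ∀ i j, 0 ≤ B i j)
    (hirr : ∀ i j, Relation.ReflTransGen (fun a b => 0 < B a b) i j) {x : V → ℝ}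
    (hx : ∀ i, 0 < x i) {ρ : ℝ} (hBx : B *ᵥ x = ρ • x) {ζ : ℂ} (hζ : ‖ζ‖ = 1)
    {v : V → ℂ} (hv : B.map ((↑) : ℝ → ℂ) *ᵥ v = ((ρ : ℂ) * ζ) • v) {i j : V} (hij : 0 < B i j) :
    v j / x j = ζ * (v i / x i) := by
  have : Nonempty V := ⟨i⟩
  obtain ⟨i₀, hi₀⟩ := Finite.exists_max fun i => ‖v i / x i‖
  set u : V → ℂ := fun i => v i / x i with hu
  have hvu : ∀ i, v i = u i * x i := fun i => by
    have : (x i : ℂ) ≠ 0 := by exact_mod_cast (hx i).ne'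
    simp only [hu]
    field_simp
  -- The weights `B a b * x b` have sum `ρ * x a`.
  have hsum : ∀ a, ∑ b, B a b * x b = ρ * x a := fun a => congrFun hBx a
  have hsumu : ∀ a, ∑ b, ((B a b * x b : ℝ) : ℂ) * u b = ((ρ * x a : ℝ) : ℂ) * (ζ * u a) := by
    intro a
    have h1 : ∑ b, (B a b : ℂ) * v b = (ρ : ℂ) * ζ * v a := congrFun hv a
    rw [hvu a] at h1
    calc ∑ b, ((B a b * x b : ℝ) : ℂ) * u b = ∑ b, (B a b : ℂ) * v b :=
          Finset.sum_congr rfl fun b _ => by rw [hvu b]; push_cast; ring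
      _ = _ := by rw [h1]; push_cast; ring
  have hstep : ∀ a, ‖u a‖ = ‖u i₀‖ → ∀ b, 0 < B a b → u b = ζ * u a := by
    intro a ha b hab
    set w := ζ * u a with hw
    have hwn : ‖w‖ = ‖u i₀‖ := by rw [hw, norm_mul, hζ, one_mul, ha]
    have hle : ∀ c, ‖u c - w‖ ^ 2 ≤ 2 * ‖w‖ ^ 2 - 2 * (u c * (starRingEnd ℂ) w).re := by
      intro c
      have h1 : ‖u c‖ ^ 2 ≤ ‖w‖ ^ 2 := by
        rw [hwn]; exact pow_le_pow_left₀ (norm_nonneg _) (hi₀ c) 2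
      have h2 := Complex.normSq_sub (u c) w
      rw [Complex.normSq_eq_norm_sq, Complex.normSq_eq_norm_sq, Complex.normSq_eq_norm_sq] at h2
      linarith
    have hre : ∑ c, B a c * x c * (u c * (starRingEnd ℂ) w).re = ρ * x a * ‖w‖ ^ 2 := by
      have h1 := congrArg (fun t => (t * (starRingEnd ℂ) w).re) (hsumu a)
      simp only [Finset.sum_mul, mul_assoc, Complex.re_sum, Complex.re_ofReal_mul] at h1
      have h2 : w * (starRingEnd ℂ) w = ((‖w‖ ^ 2 : ℝ) : ℂ) := by
        rw [Complex.mul_conj, Complex.normSq_eq_norm_sq]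
      rw [← mul_assoc ζ, ← hw, h2, Complex.ofReal_re] at h1
      simpa only [mul_assoc] using h1
    have hzero : ∑ c, B a c * x c * ‖u c - w‖ ^ 2 ≤ 0 := by
      calc ∑ c, B a c * x c * ‖u c - w‖ ^ 2
          ≤ ∑ c, B a c * x c * (2 * ‖w‖ ^ 2 - 2 * (u c * (starRingEnd ℂ) w).re) :=
            Finset.sum_le_sum fun c _ =>
              mul_le_mul_of_nonneg_left (hle c) (mul_nonneg (hB a c) (hx c).le)
        _ = 2 * ‖w‖ ^ 2 * ∑ c, B a c * x c
              - 2 * ∑ c, B a c * x c * (u c * (starRingEnd ℂ) w).re := by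
            rw [Finset.mul_sum, Finset.mul_sum, ← Finset.sum_sub_distrib]
            exact Finset.sum_congr rfl fun c _ => by ring
        _ = 0 := by rw [hsum, hre]; ring
    have hnn : ∀ c ∈ Finset.univ, 0 ≤ B a c * x c * ‖u c - w‖ ^ 2 := fun c _ =>
      mul_nonneg (mul_nonneg (hB a c) (hx c).le) (sq_nonneg _)
    have h0 := (Finset.sum_eq_zero_iff_of_nonneg hnn).1
      (le_antisymm hzero (Finset.sum_nonneg hnn)) b (Finset.mem_univ b)
    have h3 := (mul_eq_zero.1 h0).resolve_left (mul_pos hab (hx b)).ne'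
    exact sub_eq_zero.1 (norm_eq_zero.1 (pow_eq_zero_iff two_ne_zero |>.1 h3))
  have hconst : ∀ a, ‖u a‖ = ‖u i₀‖ := by
    intro a
    induction hirr i₀ a with
    | refl => rfl
    | @tail b c _ hbc ih => rw [hstep b ih c hbc, norm_mul, hζ, one_mul, ih]
  exact hstep i (hconst i) j hij

end Matrix

/-! ### The real adjacency matrix of a digraph -/

namespace FinDigraph

open Matrix

section RealMatrix

variable {V : Type*} [Quiver V] [∀ i j : V, Fintype (i ⟶ j)]

variable (V) in
/-- The adjacency matrix with real entries. -/
def adjMatrixR : Matrix V V ℝ := (adjMatrix V).map (Nat.cast : ℕ → ℝ)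

lemma adjMatrixC_eq_map : adjMatrixC V = (adjMatrixR V).map ((↑) : ℝ → ℂ) := by
  ext i j
  simp [adjMatrixC, adjMatrixR]

lemma adjMatrixR_nonneg (i j : V) : 0 ≤ adjMatrixR V i j := by simp [adjMatrixR]

lemma adjMatrixR_pos_iff {i j : V} : 0 < adjMatrixR V i j ↔ Nonempty (i ⟶ j) := by
  simp [adjMatrixR, adjMatrix, Fintype.card_pos_iff]

lemma reflTransGen_adjMatrixR (hsc : Quiver.IsStronglyConnected V) (i j : V) :
    Relation.ReflTransGen (fun a b => 0 < adjMatrixR V a b) i j := by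
  obtain ⟨p⟩ := hsc i j
  induction p with
  | nil => exact .refl
  | cons p e ih => exact ih.tail (adjMatrixR_pos_iff.2 ⟨e⟩)

variable [Fintype V]

lemma exists_arrow_of_not_isSink {i : V} (hi : ¬ IsSink i) : ∃ j, Nonempty (i ⟶ j) := by
  obtain ⟨j, -, hj⟩ := Finset.exists_ne_zero_of_sum_ne_zero hi
  exact ⟨j, Fintype.card_pos_iff.1 (Nat.pos_of_ne_zero hj)⟩

lemma exists_adjMatrixR_pos (hsink : ∀ i : V, ¬ IsSink i) (i : V) :
    ∃ j, 0 < adjMatrixR V i j := by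
  simpa only [adjMatrixR_pos_iff] using exists_arrow_of_not_isSink (hsink i)

variable [DecidableEq V]

lemma rho_eq_complexSpectralRadius : rho V = complexSpectralRadius (adjMatrixR V) := by
  rw [rho, complexSpectralRadius, adjMatrixC_eq_map]

lemma cast_kOutdegree (k : ℕ) :
    (fun i : V => (kOutdegree k i : ℝ)) = (adjMatrixR V ^ k) *ᵥ 1 := by
  have h : adjMatrixR V ^ k = (adjMatrix V ^ k).map (Nat.cast : ℕ → ℝ) :=
    (Matrix.map_pow (adjMatrix V) (Nat.castRingHom ℝ) k).symm
  ext i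
  simp [kOutdegree, h, mulVec, dotProduct]

lemma cast_kOutdegree_add (k L : ℕ) :
    (fun i : V => (kOutdegree (k + L) i : ℝ)) =
      (adjMatrixR V ^ L) *ᵥ (fun i : V => (kOutdegree k i : ℝ)) := by
  rw [cast_kOutdegree, cast_kOutdegree, mulVec_mulVec, ← pow_add, add_comm]

lemma kOutdegree_pos (hsink : ∀ i : V, ¬ IsSink i) (k : ℕ) (i : V) : 0 < (kOutdegree k i : ℝ) := by
  have h := congrFun (cast_kOutdegree (V := V) k) i
  exact h ▸ pow_mulVec_pos_of_row_pos adjMatrixR_nonneg (exists_adjMatrixR_pos hsink)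
    (fun _ => one_pos) k i

lemma one_le_rho [Nonempty V] (hsink : ∀ i : V, ¬ IsSink i) : 1 ≤ rho V := by
  rw [rho_eq_complexSpectralRadius]
  refine le_complexSpectralRadius_of_le_mulVec adjMatrixR_nonneg (z := 1) (fun _ => one_pos)
    zero_le_one fun i => ?_
  have h := congrFun (cast_kOutdegree (V := V) 1) i
  have h1 := kOutdegree_pos hsink 1 i
  rw [pow_one] at h
  rw [← h, Pi.one_apply, one_mul]
  exact_mod_cast h1

end RealMatrix

/-! ### The peripheral group and cyclic partitions -/

section Peripheral

variable {V : Type*} [Quiver V]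

lemma eq_pow_length_mul {M : Type*} [Monoid M] {ζ : M} {u : V → M}
    (hu : ∀ i j : V, Nonempty (i ⟶ j) → u j = ζ * u i) {i j : V} (p : Quiver.Path i j) :
    u j = ζ ^ p.length * u i := by
  induction p with
  | nil => simp
  | cons p e ih => rw [hu _ _ ⟨e⟩, ih, Quiver.Path.length_cons, pow_succ', mul_assoc]

variable (V) in
/-- The unimodular `ζ` for which some nowhere zero function on the vertices is multiplied by `ζ`
along every arc. For a strongly connected digraph these are the quotients `μ / ρ`, for `μ` an
eigenvalue of modulus `ρ`; described in this way they visibly form a group. -/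
def peripheralGroup : Subgroup ℂˣ where
  carrier := {ζ | ‖(ζ : ℂ)‖ = 1 ∧ ∃ u : V → ℂˣ, ∀ i j : V, Nonempty (i ⟶ j) → u j = ζ * u i}
  one_mem' := ⟨by simp, 1, fun i j _ => by simp⟩
  mul_mem' := by
    rintro a b ⟨ha, u, hu⟩ ⟨hb, w, hw⟩
    refine ⟨by simp [ha, hb], u * w, fun i j e => ?_⟩
    rw [Pi.mul_apply, Pi.mul_apply, hu i j e, hw i j e, mul_mul_mul_comm]
  inv_mem' := by
    rintro a ⟨ha, u, hu⟩
    refine ⟨by simp [ha], u⁻¹, fun i j e => ?_⟩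
    rw [Pi.inv_apply, Pi.inv_apply, hu i j e, mul_inv]

/-- A generator `ζ` of the peripheral group has order `h`, so walks from a fixed vertex to `i` have
lengths in a single class modulo `h`; that class, modulo `r`, is the block of `i`. -/
lemma exists_isCyclicPartition [Nonempty V] [Finite (peripheralGroup V)]
    (hsc : Quiver.IsStronglyConnected V) (hout : ∀ i : V, ∃ j, Nonempty (i ⟶ j)) {r : ℕ}
    (hr : r ∣ Nat.card (peripheralGroup V)) : ∃ m : V → ZMod r, IsCyclicPartition m := by
  obtain ⟨g, hg⟩ := IsCyclic.exists_generator (α := peripheralGroup V)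
  have hord : orderOf (g : ℂˣ) = Nat.card (peripheralGroup V) := by
    rw [Subgroup.orderOf_coe]; exact orderOf_eq_card_of_forall_mem_zpowers hg
  have hr0 : NeZero r := ⟨fun h => Nat.card_pos.ne' (Nat.eq_zero_of_zero_dvd (h ▸ hr))⟩
  obtain ⟨-, u, hu⟩ := g.2
  obtain ⟨v₀⟩ := ‹Nonempty V›
  set ℓ : V → ℕ := fun i => (hsc v₀ i).some.length with hℓ
  have hul : ∀ i, u i = (g : ℂˣ) ^ ℓ i * u v₀ := fun i => eq_pow_length_mul hu (hsc v₀ i).some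
  have hstep : ∀ i j : V, Nonempty (i ⟶ j) → (ℓ j : ZMod r) = ℓ i + 1 := by
    intro i j e
    have h1 : (g : ℂˣ) ^ ℓ j = (g : ℂˣ) ^ (ℓ i + 1) := by
      refine mul_right_cancel (b := u v₀) ?_
      rw [← hul j, hu i j e, hul i, pow_succ', mul_assoc]
    have h2 : ℓ j ≡ ℓ i + 1 [MOD r] := by
      rw [pow_eq_pow_iff_modEq, hord] at h1
      exact h1.of_dvd hr
    exact_mod_cast (ZMod.natCast_eq_natCast_iff _ _ _).2 h2
  have hsurj : ∀ n : ℕ, ∃ i, (ℓ i : ZMod r) = ℓ v₀ + n := by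
    intro n
    induction n with
    | zero => exact ⟨v₀, by simp⟩
    | succ n ih =>
      obtain ⟨i, hi⟩ := ih
      obtain ⟨j, hj⟩ := hout i
      exact ⟨j, by rw [hstep i j hj, hi]; push_cast; ring⟩
  refine ⟨fun i => (ℓ i : ZMod r), fun t => ?_, hstep⟩
  obtain ⟨i, hi⟩ := hsurj (t - ℓ v₀).val
  exact ⟨i, by simp only [hi, ZMod.natCast_zmod_val]; ring⟩

lemma IsCyclicPartition.eq_add_length {r : ℕ} {m : V → ZMod r} (hm : IsCyclicPartition m) {i j : V}
    (p : Quiver.Path i j) : m j = m i + p.length := by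
  induction p with
  | nil => simp
  | cons p e ih => rw [hm.2 _ _ ⟨e⟩, ih, Quiver.Path.length_cons]; push_cast; ring

variable [∀ i j : V, Fintype (i ⟶ j)] [Fintype V]

/-- An eigenvector for `ρ ζ`, divided by the Perron vector `x`, is multiplied by `ζ` along arcs. -/
lemma div_eq_mul_div_of_arrow (hsc : Quiver.IsStronglyConnected V) {x : V → ℝ}
    (hx : ∀ i, 0 < x i) {ρ : ℝ} (hBx : adjMatrixR V *ᵥ x = ρ • x) {ζ : ℂ}
    (hζ : ‖ζ‖ = 1) {v : V → ℂ} (hv : adjMatrixC V *ᵥ v = ((ρ : ℂ) * ζ) • v) (i j : V)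
    (e : Nonempty (i ⟶ j)) : v j / x j = ζ * (v i / x i) := by
  rw [adjMatrixC_eq_map] at hv
  exact div_eq_mul_div_of_peripheral adjMatrixR_nonneg (reflTransGen_adjMatrixR hsc) hx hBx hζ hv
    (adjMatrixR_pos_iff.2 e)

lemma mk0_mem_peripheralGroup (hsc : Quiver.IsStronglyConnected V) {x : V → ℝ}
    (hx : ∀ i, 0 < x i) {ρ : ℝ} (hBx : adjMatrixR V *ᵥ x = ρ • x) {ζ : ℂ}
    (hζ : ‖ζ‖ = 1) (hζ0 : ζ ≠ 0) {v : V → ℂ} (hv0 : v ≠ 0)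
    (hv : adjMatrixC V *ᵥ v = ((ρ : ℂ) * ζ) • v) : Units.mk0 ζ hζ0 ∈ peripheralGroup V := by
  have hstep := div_eq_mul_div_of_arrow hsc hx hBx hζ hv
  obtain ⟨i₀, hi₀⟩ := Function.ne_iff.1 hv0
  have hne : ∀ i, v i / (x i : ℂ) ≠ 0 := by
    intro i
    obtain ⟨p⟩ := hsc i₀ i
    rw [eq_pow_length_mul (u := fun i => v i / (x i : ℂ)) hstep p]
    exact mul_ne_zero (pow_ne_zero _ hζ0)
      (div_ne_zero hi₀ (Complex.ofReal_ne_zero.2 (hx i₀).ne'))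
  exact ⟨hζ, fun i => Units.mk0 _ (hne i), fun i j e => Units.ext (hstep i j e)⟩

variable [DecidableEq V] [Nonempty V]

/-- The eigenvalues of modulus `ρ` are the multiples by `ρ` of the peripheral group. -/
lemma peripheral_spectrum_eq_image (hsc : Quiver.IsStronglyConnected V) {x : V → ℝ}
    (hx : ∀ i, 0 < x i) (hρ : 0 < rho V) (hBx : adjMatrixR V *ᵥ x = rho V • x) :
    {μ : ℂ | μ ∈ spectrum ℂ (adjMatrixC V) ∧ ‖μ‖ = rho V} =
      (fun ζ : ℂˣ => (rho V : ℂ) * ζ) '' (peripheralGroup V : Set ℂˣ) := by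
  have hρC : (rho V : ℂ) ≠ 0 := Complex.ofReal_ne_zero.2 hρ.ne'
  ext μ
  constructor
  · rintro ⟨hμ, hn⟩
    obtain ⟨v, hv0, hv⟩ := mem_spectrum_iff_exists_mulVec_eq_smul.1 hμ
    have hζ : ‖μ / rho V‖ = 1 := by
      rw [norm_div, hn, Complex.norm_real, Real.norm_of_nonneg hρ.le, div_self hρ.ne']
    have hζ0 : μ / rho V ≠ 0 := fun h => by rw [h, norm_zero] at hζ; exact zero_ne_one hζ
    have hmul : (rho V : ℂ) * (μ / rho V) = μ := mul_div_cancel₀ _ hρC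
    exact ⟨Units.mk0 _ hζ0, mk0_mem_peripheralGroup hsc hx hBx hζ hζ0 hv0 (by rw [hmul, hv]), hmul⟩
  · rintro ⟨ζ, ⟨hζ, u, hu⟩, rfl⟩
    refine ⟨mem_spectrum_iff_exists_mulVec_eq_smul.2 ⟨fun i => x i * u i, ?_, ?_⟩, ?_⟩
    · obtain ⟨i⟩ := ‹Nonempty V›
      exact Function.ne_iff.2
        ⟨i, mul_ne_zero (Complex.ofReal_ne_zero.2 (hx i).ne') (u i).ne_zero⟩
    · ext i
      have hBxi : ∑ j, adjMatrixR V i j * x j = rho V * x i := congrFun hBx i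
      calc ∑ j, adjMatrixC V i j * (x j * u j)
          = ∑ j, ((adjMatrixR V i j * x j : ℝ) : ℂ) * (ζ * u i) := by
            refine Finset.sum_congr rfl fun j _ => ?_
            rw [adjMatrixC_eq_map, map_apply]
            by_cases h : Nonempty (i ⟶ j)
            · rw [hu i j h]; push_cast; ring
            · have h0 : adjMatrixR V i j = 0 := le_antisymm
                (not_lt.1 fun h' => h (adjMatrixR_pos_iff.1 h')) (adjMatrixR_nonneg i j)
              rw [h0]; simp
        _ = (rho V : ℂ) * ζ * (x i * u i) := by
            rw [← Finset.sum_mul, ← Complex.ofReal_sum, hBxi]; push_cast; ring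
    · simp [hζ, hρ.le]

lemma finite_peripheralGroup_and_card_eq (hsc : Quiver.IsStronglyConnected V) {x : V → ℝ}
    (hx : ∀ i, 0 < x i) (hρ : 0 < rho V) (hBx : adjMatrixR V *ᵥ x = rho V • x) :
    Finite (peripheralGroup V) ∧ Nat.card (peripheralGroup V) = imprimitivityIndex V := by
  have himg := peripheral_spectrum_eq_image hsc hx hρ hBx
  have hinj : Function.Injective fun ζ : ℂˣ => (rho V : ℂ) * ζ := fun a b h =>
    Units.ext (mul_left_cancel₀ (Complex.ofReal_ne_zero.2 hρ.ne') h)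
  constructor
  · refine Set.Finite.of_finite_image (f := fun ζ : ℂˣ => (rho V : ℂ) * ζ) ?_ hinj.injOn
    rw [← himg]
    exact (Matrix.finite_spectrum _).subset fun μ hμ => hμ.1
  · rw [imprimitivityIndex, himg, Set.ncard_image_of_injective _ hinj, ← Nat.card_coe_set_eq]
    rfl

end Peripheral

end FinDigraph

/-! ### Decomposition of a positive eigenvector of a power -/

namespace Matrix

variable {V : Type*} [Fintype V] [DecidableEq V]

/-- Discrete Fourier transform over the `L`-th roots of unity: an eigenvector `d` of `A ^ L` for
`ρ ^ L` is, up to a nonzero factor, a sum of eigenvectors of `A` for the numbers `ρ ζ` with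
`ζ ^ L = 1`. -/
lemma exists_sum_eigenvectors_of_pow_mulVec_eq {A : Matrix V V ℂ} {ρ : ℂ} (hρ : ρ ≠ 0) {d : V → ℂ}
    {L : ℕ} (hL : 0 < L) (h : (A ^ L) *ᵥ d = ρ ^ L • d) :
    ∃ (ζ : ℕ → ℂ) (w : ℕ → V → ℂ), (∀ a, ζ a ^ L = 1) ∧ (∀ a, A *ᵥ w a = (ρ * ζ a) • w a) ∧
      ∃ c : ℂ, c ≠ 0 ∧ ∑ a ∈ Finset.range L, ζ a • w a = c • d := by
  have hω : IsPrimitiveRoot (Complex.exp (2 * Real.pi * Complex.I / L)) L :=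
    Complex.isPrimitiveRoot_exp L hL.ne'
  set ω : ℂ := Complex.exp (2 * Real.pi * Complex.I / L) with hωdef
  have hζ : ∀ a, (ω ^ a) ^ L = 1 := fun a => by rw [← pow_mul, mul_comm, pow_mul, hω.pow_eq_one,
    one_pow]
  refine ⟨fun a => ω ^ a,
    fun a => ∑ s ∈ Finset.range L, (ρ * ω ^ a) ^ (L - 1 - s) • ((A ^ s) *ᵥ d), hζ, fun a => ?_,
    L * ρ ^ (L - 1), mul_ne_zero (Nat.cast_ne_zero.2 hL.ne') (pow_ne_zero _ hρ), ?_⟩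
  · refine sub_eq_zero.1 ?_
    rw [mulVec_geom_sum, mul_pow, hζ, mul_one, h, sub_self]
  · -- The coefficient of `A ^ s d` is a full sum of powers of `ω ^ (L - s)`.
    have hcoef : ∀ s ∈ Finset.range L, s ≠ 0 →
        ∑ a ∈ Finset.range L, ω ^ a * (ρ * ω ^ a) ^ (L - 1 - s) = 0 := by
      intro s hs hs0
      have hsL := Finset.mem_range.1 hs
      have hne : ω ^ (L - s) ≠ 1 := hω.pow_ne_one_of_pos_of_lt (by omega) (by omega)
      have hgeom : ∑ a ∈ Finset.range L, (ω ^ (L - s)) ^ a = 0 := by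
        have h1 := geom_sum_mul (ω ^ (L - s)) L
        rw [hζ, sub_self] at h1
        exact (mul_eq_zero.1 h1).resolve_right (sub_ne_zero.2 hne)
      have : ∀ a, ω ^ a * (ρ * ω ^ a) ^ (L - 1 - s) = ρ ^ (L - 1 - s) * (ω ^ (L - s)) ^ a := by
        intro a
        rw [mul_pow, ← pow_mul ω (L - s), mul_comm (L - s), pow_mul ω a,
          show L - s = L - 1 - s + 1 by omega, pow_succ]
        ring
      rw [Finset.sum_congr rfl fun a _ => this a, ← Finset.mul_sum, hgeom, mul_zero]
    have hcoef0 : ∑ a ∈ Finset.range L, ω ^ a * (ρ * ω ^ a) ^ (L - 1 - 0) = L * ρ ^ (L - 1) := by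
      have : ∀ a, ω ^ a * (ρ * ω ^ a) ^ (L - 1 - 0) = ρ ^ (L - 1) := by
        intro a
        rw [Nat.sub_zero, mul_pow, mul_left_comm, ← pow_succ', Nat.sub_add_cancel hL, hζ, mul_one]
      rw [Finset.sum_congr rfl fun a _ => this a, Finset.sum_const, Finset.card_range, nsmul_eq_mul]
    simp only [Finset.smul_sum, smul_smul]
    rw [Finset.sum_comm]
    simp only [← Finset.sum_smul]
    rw [Finset.sum_eq_single_of_mem 0 (Finset.mem_range.2 hL)
      fun s hs hs0 => by rw [hcoef s hs hs0, zero_smul], hcoef0, pow_zero, one_mulVec]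

end Matrix

namespace FinDigraph

open Matrix

variable {V : Type*} [Quiver V] [∀ i j : V, Fintype (i ⟶ j)] [Fintype V] [DecidableEq V]

/-- If `A ^ L d = ρ ^ L d` with `d > 0`, then `(A d) i / d i` depends only on the block of `i` in
the cyclic partition modulo `gcd L h`. Indeed `d` is a sum of eigenvectors for eigenvalues `ρ ζ`
with `ζ ^ L = 1` and `ζ ^ h = 1`, and each of these, divided by the Perron vector, is multiplied by `ζ`
along arcs, hence constant on blocks. -/
lemma exists_isCyclicPartition_div_eq [Nonempty V] (hsink : ∀ i : V, ¬ IsSink i)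
    (hsc : Quiver.IsStronglyConnected V) {d : V → ℝ} (hd : ∀ i, 0 < d i) {L : ℕ} (hL : 0 < L)
    (h : (adjMatrixR V ^ L) *ᵥ d = rho V ^ L • d) :
    ∃ m : V → ZMod (Nat.gcd L (imprimitivityIndex V)), IsCyclicPartition m ∧
      ∀ i i', m i = m i' → (adjMatrixR V *ᵥ d) i / d i = (adjMatrixR V *ᵥ d) i' / d i' := by
  have hρ : 0 < rho V := zero_lt_one.trans_le (one_le_rho hsink)
  obtain ⟨x, hx, hBx⟩ : ∃ x : V → ℝ, (∀ i, 0 < x i) ∧ adjMatrixR V *ᵥ x = rho V • x :=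
    ⟨_, geom_sum_mulVec_pos adjMatrixR_nonneg (exists_adjMatrixR_pos hsink) hd hρ.le hL,
      sub_eq_zero.1 (by rw [mulVec_geom_sum, h, sub_self])⟩
  obtain ⟨hfin, hcard⟩ := finite_peripheralGroup_and_card_eq hsc hx hρ hBx
  obtain ⟨m, hm⟩ := exists_isCyclicPartition (r := Nat.gcd L (imprimitivityIndex V)) hsc
    (fun i => exists_arrow_of_not_isSink (hsink i)) (by rw [hcard]; exact Nat.gcd_dvd_right _ _)
  refine ⟨m, hm, fun i i' hii => ?_⟩
  have hC : ∀ (M : Matrix V V ℝ) (y : V → ℝ), M.map ((↑) : ℝ → ℂ) *ᵥ (fun i => (y i : ℂ)) =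
      fun i => ((M *ᵥ y) i : ℂ) := fun M y => by
    ext i; simp [mulVec, dotProduct]
  have hApow : (adjMatrixC V ^ L) *ᵥ (fun i => (d i : ℂ)) =
      (rho V : ℂ) ^ L • fun i => (d i : ℂ) := by
    have h1 : adjMatrixC V ^ L = (adjMatrixR V ^ L).map ((↑) : ℝ → ℂ) := by
      rw [adjMatrixC_eq_map]
      exact (Matrix.map_pow (adjMatrixR V) Complex.ofRealHom L).symm
    rw [h1, hC, h]
    ext i
    simp
  obtain ⟨ζ, w, hζL, hw, c, hc, hsum⟩ := exists_sum_eigenvectors_of_pow_mulVec_eq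
    (Complex.ofReal_ne_zero.2 hρ.ne') hL hApow
  have hwi : ∀ a, w a i / x i = w a i' / x i' := by
    intro a
    by_cases hwa : w a = 0
    · simp [hwa]
    have hζn : ‖ζ a‖ = 1 := Complex.norm_eq_one_of_pow_eq_one (hζL a) hL.ne'
    have hζ0 : ζ a ≠ 0 := fun h0 => by simp [h0] at hζn
    have hmem := mk0_mem_peripheralGroup hsc hx hBx hζn hζ0 hwa (hw a)
    have hζh : ζ a ^ imprimitivityIndex V = 1 := by
      have h1 : (⟨_, hmem⟩ : peripheralGroup V) ^ Nat.card (peripheralGroup V) = 1 :=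
        pow_card_eq_one'
      rw [hcard] at h1
      simpa using congrArg (fun t : peripheralGroup V => ((t : ℂˣ) : ℂ)) h1
    obtain ⟨p⟩ := hsc i i'
    have hdvd : Nat.gcd L (imprimitivityIndex V) ∣ p.length := by
      have h1 := hm.eq_add_length p
      rw [← hii, left_eq_add] at h1
      exact (ZMod.natCast_eq_zero_iff _ _).1 h1
    have hζp : ζ a ^ p.length = 1 := by
      rw [← orderOf_dvd_iff_pow_eq_one] at hζh ⊢
      exact (Nat.dvd_gcd (orderOf_dvd_of_pow_eq_one (hζL a)) hζh).trans hdvd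
    have h2 := eq_pow_length_mul (u := fun i => w a i / (x i : ℂ))
      (div_eq_mul_div_of_arrow hsc hx hBx hζn (hw a)) p
    rw [hζp, one_mul] at h2
    exact h2.symm
  have hdx : d i / x i = d i' / x i' := by
    have h1 : ∀ j, ((d j / x j : ℝ) : ℂ) =
        c⁻¹ * ∑ a ∈ Finset.range L, ζ a * (w a j / x j) := by
      intro j
      have h2 := congrFun hsum j
      simp only [Finset.sum_apply, Pi.smul_apply, smul_eq_mul] at h2
      simp only [← mul_div_assoc, ← Finset.sum_div]
      rw [h2, inv_mul_cancel_left₀ hc, Complex.ofReal_div]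
    refine Complex.ofReal_injective ?_
    rw [h1, h1]
    simp only [hwi]
  have hBdx : (adjMatrixR V *ᵥ d) i / x i = (adjMatrixR V *ᵥ d) i' / x i' := by
    have h1 : ∀ j, (((adjMatrixR V *ᵥ d) j / x j : ℝ) : ℂ) =
        c⁻¹ * ∑ a ∈ Finset.range L, ζ a * (rho V * ζ a * (w a j / x j)) := by
      intro j
      have h2 := congrFun (congrArg (fun t => adjMatrixC V *ᵥ t) hsum) j
      simp only [mulVec_sum, mulVec_smul, hw] at h2
      simp only [adjMatrixC_eq_map, hC, Finset.sum_apply, Pi.smul_apply, smul_eq_mul] at h2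
      simp only [← mul_div_assoc, ← Finset.sum_div]
      rw [h2, inv_mul_cancel_left₀ hc, Complex.ofReal_div]
    refine Complex.ofReal_injective ?_
    rw [h1, h1]
    simp only [hwi]
  rw [← div_div_div_cancel_right₀ (hx i).ne', hdx, hBdx,
    div_div_div_cancel_right₀ (hx i').ne']

/-! ### Bounds for the spectral radius and the equality case -/

lemma meanGrowth_pow (hsink : ∀ i : V, ¬ IsSink i) (k : ℕ) {L : ℕ} (hL : 0 < L) (i : V) :
    meanGrowth k L i ^ L * kOutdegree k i = kOutdegree (k + L) i := by
  have h := kOutdegree_pos hsink k i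
  have h' := kOutdegree_pos hsink (k + L) i
  rw [meanGrowth, one_div, Real.rpow_inv_natCast_pow (div_pos h' h).le hL.ne',
    div_mul_cancel₀ _ h.ne']

lemma meanGrowth_nonneg (k L : ℕ) (i : V) : 0 ≤ meanGrowth k L i :=
  Real.rpow_nonneg (div_nonneg (Nat.cast_nonneg _) (Nat.cast_nonneg _)) _

lemma le_rho_of_forall_le_meanGrowth [Nonempty V] (hsink : ∀ i : V, ¬ IsSink i)
    {k L : ℕ} (hL : 0 < L) {γ : ℝ}
    (hγ : 0 ≤ γ) (h : ∀ i : V, γ ≤ meanGrowth k L i) : γ ≤ rho V := by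
  rw [rho_eq_complexSpectralRadius]
  refine le_complexSpectralRadius_of_le_pow_mulVec adjMatrixR_nonneg (exists_adjMatrixR_pos hsink)
    (kOutdegree_pos hsink k) hγ hL fun i => ?_
  rw [← cast_kOutdegree_add]
  beta_reduce
  rw [← meanGrowth_pow hsink k hL i]
  exact mul_le_mul_of_nonneg_right (pow_le_pow_left₀ hγ (h i) L) (Nat.cast_nonneg _)

lemma rho_le_of_forall_meanGrowth_le [Nonempty V] (hsink : ∀ i : V, ¬ IsSink i)
    {k L : ℕ} (hL : 0 < L) {γ : ℝ}
    (h : ∀ i : V, meanGrowth k L i ≤ γ) : rho V ≤ γ := by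
  have hγ : 0 ≤ γ := (meanGrowth_nonneg k L (Classical.arbitrary V)).trans (h _)
  rw [rho_eq_complexSpectralRadius]
  refine complexSpectralRadius_le_of_pow_mulVec_le adjMatrixR_nonneg (exists_adjMatrixR_pos hsink)
    (kOutdegree_pos hsink k) hγ hL fun i => ?_
  rw [← cast_kOutdegree_add]
  beta_reduce
  rw [← meanGrowth_pow hsink k hL i]
  exact mul_le_mul_of_nonneg_right
    (pow_le_pow_left₀ (meanGrowth_nonneg k L i) (h i) L) (Nat.cast_nonneg _)

/-- On a strongly connected digraph, if all the `meanGrowth k L i` lie on one side of `ρ`, then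
the vector of `k`-outdegrees is an eigenvector of `A ^ L`. -/
lemma pow_mulVec_kOutdegree_eq [Nonempty V] (hsink : ∀ i : V, ¬ IsSink i)
    (hsc : Quiver.IsStronglyConnected V) {k L : ℕ} (hL : 0 < L)
    (h : (∀ i : V, rho V ≤ meanGrowth k L i) ∨ ∀ i : V, meanGrowth k L i ≤ rho V) :
    (adjMatrixR V ^ L) *ᵥ (fun i : V => (kOutdegree k i : ℝ)) =
      rho V ^ L • fun i : V => (kOutdegree k i : ℝ) := by
  have hρ : 0 ≤ rho V := zero_le_one.trans (one_le_rho hsink)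
  -- The eigenvalue equation for `x = ∑ ρ ^ (L - 1 - s) A ^ s d` is the claim for `d`.
  have hgeom := mulVec_geom_sum (adjMatrixR V) (rho V) (fun i : V => (kOutdegree k i : ℝ)) L
  have hx := geom_sum_mulVec_pos adjMatrixR_nonneg (exists_adjMatrixR_pos hsink)
    (kOutdegree_pos hsink k) hρ hL
  set x := ∑ s ∈ Finset.range L,
    rho V ^ (L - 1 - s) • ((adjMatrixR V ^ s) *ᵥ fun i : V => (kOutdegree k i : ℝ))
  have hgeom' : ∀ i, (adjMatrixR V *ᵥ x) i - rho V * x i =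
      (meanGrowth k L i ^ L - rho V ^ L) * kOutdegree k i := by
    intro i
    have h1 := congrFun hgeom i
    rw [← cast_kOutdegree_add] at h1
    simp only [Pi.sub_apply, Pi.smul_apply, smul_eq_mul] at h1
    rw [h1, sub_mul, meanGrowth_pow hsink k hL]
  suffices hBx : adjMatrixR V *ᵥ x = rho V • x by
    rw [hBx, sub_self] at hgeom
    exact (sub_eq_zero.1 hgeom.symm)
  rcases h with h | h
  · rw [rho_eq_complexSpectralRadius]
    refine mulVec_eq_of_complexSpectralRadius_le adjMatrixR_nonneg (reflTransGen_adjMatrixR hsc) hx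
      fun i => ?_
    rw [← rho_eq_complexSpectralRadius, ← sub_nonneg, hgeom' i]
    exact mul_nonneg (sub_nonneg.2 (pow_le_pow_left₀ hρ (h i) L)) (Nat.cast_nonneg _)
  · rw [rho_eq_complexSpectralRadius]
    refine mulVec_eq_of_le_complexSpectralRadius adjMatrixR_nonneg (reflTransGen_adjMatrixR hsc) hx
      fun i => ?_
    rw [← rho_eq_complexSpectralRadius, ← sub_nonpos, hgeom' i]
    exact mul_nonpos_of_nonpos_of_nonneg
      (sub_nonpos.2 (pow_le_pow_left₀ (meanGrowth_nonneg k L i) (h i) L)) (Nat.cast_nonneg _)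

lemma isAverageOutdegreeRegular_or_quasiregular [Nonempty V] (hsink : ∀ i : V, ¬ IsSink i)
    (hsc : Quiver.IsStronglyConnected V) {k L : ℕ} (hL : 0 < L)
    (h : (∀ i : V, rho V ≤ meanGrowth k L i) ∨ ∀ i : V, meanGrowth k L i ≤ rho V) :
    IsAverageOutdegreeRegular V (k + 1) ∨
      IsAverageOutdegreeQuasiregular V (k + 1) (Nat.gcd L (imprimitivityIndex V)) := by
  obtain ⟨m, hm, hdiv⟩ := exists_isCyclicPartition_div_eq hsink hsc (kOutdegree_pos hsink k) hL
    (pow_mulVec_kOutdegree_eq hsink hsc hL h)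
  have hone := cast_kOutdegree_add (V := V) k 1
  rw [pow_one] at hone
  rw [← hone] at hdiv
  have hr0 : 0 < Nat.gcd L (imprimitivityIndex V) := Nat.gcd_pos_of_pos_left _ hL
  rcases (Nat.succ_le_of_lt hr0).eq_or_lt with h1 | h1
  · -- There is a single block.
    have hsub : Subsingleton (ZMod (Nat.gcd L (imprimitivityIndex V))) := by
      rw [← h1]; infer_instance
    exact Or.inl ⟨Nat.le_add_left 1 k, _,
      fun i => hdiv i (Classical.arbitrary V) (Subsingleton.elim _ _)⟩
  · refine Or.inr ⟨Nat.le_add_left 1 k, ⟨h1, Nat.gcd_dvd_right _ _⟩, m, hm, ?_⟩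
    choose s hs using hm.1
    exact ⟨fun t => kOutdegree (k + 1) (s t) / kOutdegree k (s t),
      fun i => hdiv i (s (m i)) (hs (m i)).symm⟩

/-- If `A d` is `c (m i)` times `d` at `i`, where `m` increases by one along arcs, then each further
application of `A` multiplies by the factor of the next block. -/
lemma pow_mulVec_eq_prod {r : ℕ} {m : V → ZMod r}
    (hm : ∀ i j : V, Nonempty (i ⟶ j) → m j = m i + 1) {c : ZMod r → ℝ} {d : V → ℝ}
    (h : ∀ i, (adjMatrixR V *ᵥ d) i = c (m i) * d i) (n : ℕ) (i : V) :
    ((adjMatrixR V ^ n) *ᵥ d) i = (∏ s ∈ Finset.range n, c (m i + s)) * d i := by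
  induction n generalizing i with
  | zero => simp
  | succ n ih =>
    rw [pow_succ', ← mulVec_mulVec, Finset.prod_range_succ']
    calc ∑ j, adjMatrixR V i j * ((adjMatrixR V ^ n) *ᵥ d) j
        = ∑ j, (∏ s ∈ Finset.range n, c (m i + (s + 1 : ℕ))) * (adjMatrixR V i j * d j) := by
          refine Finset.sum_congr rfl fun j _ => ?_
          by_cases hij : Nonempty (i ⟶ j)
          · rw [ih, hm i j hij]
            have : ∀ s : ℕ, m i + 1 + (s : ZMod r) = m i + (s + 1 : ℕ) := fun s => by
              push_cast; ring
            simp only [this]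
            ring
          · have h0 : adjMatrixR V i j = 0 := le_antisymm
              (not_lt.1 fun h' => hij (adjMatrixR_pos_iff.1 h')) (adjMatrixR_nonneg i j)
            rw [h0]; simp
      _ = (∏ s ∈ Finset.range n, c (m i + (s + 1 : ℕ))) * (adjMatrixR V *ᵥ d) i := by
          rw [← Finset.mul_sum]; rfl
      _ = _ := by rw [h i]; simp only [Nat.cast_zero, add_zero]; ring

/-- A product over `L` consecutive residues modulo a divisor `r` of `L` consists of `L / r` full
turns, so it does not depend on where it starts. -/
lemma prod_range_add_eq {r L : ℕ} [NeZero r] (hrL : r ∣ L) (c : ZMod r → ℝ) (t : ZMod r) :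
    ∏ s ∈ Finset.range L, c (t + s) = (∏ a, c a) ^ (L / r) := by
  obtain ⟨q, rfl⟩ := hrL
  rw [Nat.mul_div_cancel_left _ (Nat.pos_of_neZero r)]
  induction q with
  | zero => simp
  | succ q ih =>
    rw [Nat.mul_succ, Finset.prod_range_add, ih, pow_succ]
    congr 1
    calc ∏ s ∈ Finset.range r, c (t + (r * q + s : ℕ))
        = ∏ s ∈ Finset.range r, c (t + (s : ZMod r)) :=
          Finset.prod_congr rfl fun s _ => by simp
      _ = ∏ a : ZMod r, c (t + a) := by
          refine Finset.prod_bij' (fun s _ => (s : ZMod r)) (fun a _ => a.val) ?_ ?_ ?_ ?_ ?_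
          · simp
          · intro a _; exact Finset.mem_range.2 a.val_lt
          · intro s hs; exact ZMod.val_cast_of_lt (Finset.mem_range.1 hs)
          · intro a _; exact ZMod.natCast_zmod_val a
          · simp
      _ = ∏ a, c a := Fintype.prod_equiv (Equiv.addLeft t) _ _ fun _ => rfl

lemma meanGrowth_eq_rho [Nonempty V] (hsink : ∀ i : V, ¬ IsSink i) {k L : ℕ} (hL : 0 < L)
    (h : IsAverageOutdegreeRegular V (k + 1) ∨
      IsAverageOutdegreeQuasiregular V (k + 1) (Nat.gcd L (imprimitivityIndex V))) (i : V) :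
    meanGrowth k L i = rho V := by
  have hone := cast_kOutdegree_add (V := V) k 1
  rw [pow_one] at hone
  have hmul : ∀ (j : V) (a : ℝ), (kOutdegree (k + 1) j : ℝ) / kOutdegree (k + 1 - 1) j = a →
      (adjMatrixR V *ᵥ fun i : V => (kOutdegree k i : ℝ)) j = a * kOutdegree k j := by
    intro j a hj
    rw [← hone, ← hj, Nat.add_sub_cancel, div_mul_cancel₀ _ (kOutdegree_pos hsink k j).ne']
  have hconst : ∃ C : ℝ, ∀ j : V, (kOutdegree (k + L) j : ℝ) / kOutdegree k j = C := by
    suffices ∃ C : ℝ, ∀ j : V,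
        ((adjMatrixR V ^ L) *ᵥ fun i : V => (kOutdegree k i : ℝ)) j = C * kOutdegree k j by
      obtain ⟨C, hC⟩ := this
      refine ⟨C, fun j => ?_⟩
      rw [div_eq_iff (kOutdegree_pos hsink k j).ne', ← hC, ← cast_kOutdegree_add]
    rcases h with ⟨-, c, hc⟩ | ⟨-, ⟨hr, -⟩, m, hm, c, hc⟩
    · -- The regular case is a cyclic partition into one part.
      exact ⟨_, fun j => (pow_mulVec_eq_prod (r := 1) (m := 0) (c := fun _ => c)
        (fun _ _ _ => Subsingleton.elim _ _) (fun j => hmul j c (hc j)) L j).trans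
        (by rw [Finset.prod_const])⟩
    · have : NeZero (Nat.gcd L (imprimitivityIndex V)) := ⟨by omega⟩
      exact ⟨_, fun j => (pow_mulVec_eq_prod hm.2 (fun j => hmul j _ (hc j)) L j).trans
        (by rw [prod_range_add_eq (Nat.gcd_dvd_left _ _)])⟩
  obtain ⟨C, hC⟩ := hconst
  have heq : ∀ j : V, meanGrowth k L j = meanGrowth k L i := fun j => by
    simp only [meanGrowth, hC]
  exact le_antisymm
    (le_rho_of_forall_le_meanGrowth hsink hL (meanGrowth_nonneg k L i) fun j => (heq j).ge)
    (rho_le_of_forall_meanGrowth_le hsink hL fun j => (heq j).le)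

end FinDigraph

theorem mainTheorem2 {V : Type*} [Quiver V] [∀ i j : V, Fintype (i ⟶ j)] [Fintype V]
    [DecidableEq V] [Nonempty V] (hsink : ∀ i : V, ¬ FinDigraph.IsSink i)
    (L k : ℕ) (hL : 0 < L) :
    (Finset.univ.inf' Finset.univ_nonempty (fun i : V => FinDigraph.meanGrowth k L i)
        ≤ FinDigraph.rho V ∧
      FinDigraph.rho V
        ≤ Finset.univ.sup' Finset.univ_nonempty (fun i : V => FinDigraph.meanGrowth k L i)) ∧
    (Quiver.IsStronglyConnected V →
      (Finset.univ.inf' Finset.univ_nonempty (fun i : V => FinDigraph.meanGrowth k L i)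
          = FinDigraph.rho V ↔
        (FinDigraph.IsAverageOutdegreeRegular V (k + 1) ∨
          FinDigraph.IsAverageOutdegreeQuasiregular V (k + 1)
            (Nat.gcd L (FinDigraph.imprimitivityIndex V)))) ∧
      (FinDigraph.rho V
          = Finset.univ.sup' Finset.univ_nonempty (fun i : V => FinDigraph.meanGrowth k L i) ↔
        (FinDigraph.IsAverageOutdegreeRegular V (k + 1) ∨
          FinDigraph.IsAverageOutdegreeQuasiregular V (k + 1)
            (Nat.gcd L (FinDigraph.imprimitivityIndex V))))) := by
  refine ⟨⟨?_, ?_⟩, fun hsc => ⟨⟨fun h => ?_, fun h => ?_⟩, ⟨fun h => ?_, fun h => ?_⟩⟩⟩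
  · exact FinDigraph.le_rho_of_forall_le_meanGrowth (k := k) hsink hL
      (Finset.le_inf' _ _ fun i _ => FinDigraph.meanGrowth_nonneg k L i)
      fun i => Finset.inf'_le _ (Finset.mem_univ i)
  · exact FinDigraph.rho_le_of_forall_meanGrowth_le (k := k) hsink hL
      fun i => Finset.le_sup' (FinDigraph.meanGrowth k L) (Finset.mem_univ i)
  · exact FinDigraph.isAverageOutdegreeRegular_or_quasiregular hsink hsc hL
      (Or.inl fun i => h ▸ Finset.inf'_le _ (Finset.mem_univ i))
  · simp only [FinDigraph.meanGrowth_eq_rho hsink hL h, Finset.inf'_const]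
  · exact FinDigraph.isAverageOutdegreeRegular_or_quasiregular hsink hsc hL
      (Or.inr fun i => h ▸ Finset.le_sup' (FinDigraph.meanGrowth k L) (Finset.mem_univ i))
  · simp only [FinDigraph.meanGrowth_eq_rho hsink hL h, Finset.sup'_const]
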